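/- Let $\mathcal N=\langle S,A,\iota,\{p_i\}_{i\in I}\rangle$ be a multiple-environment MDP (MEMDP): $S$, $A$ and $I\neq\emptyset$ are finite sets of states, actions and environments, $\iota$ is a probability distribution on $S$, and $p_i(s,a)$ is a probability distribution on $S$ for all $i\in I$, $s\in S$, $a\in A$. Let $T\subseteq S$. A policy is a map $\sigma$ from finite paths $s_0a_0s_1\cdots s_n$ to probability distributions on $A$; it is winning for $(\mathcal N,T)$ if for every $i\in I$ the run induced by $\sigma$ in the MDP $\langle S,A,\iota,p_i\rangle$, with $s_0\sim\iota$, visits $T$ with probability $1$. The belief-observation MDP $\mathcal G_{\mathcal N}$ is the partially observable MDP with states $S\times I\times 2^I$, actions $A$, initial distribution $\iota'(s,j,I)=\iota(s)/|I|$ (and $0$ on states $(s,j,J)$ with $J\ne I$), transitions from $(s,j,J)$ under $a$ to $(s',j,J')$ with probability $p_j(s,a)(s')$, where $J'=\{i\in J : p_i(s,a)(s')>0\}$ (all other transition probabilities being $0$), and observation function $O(s,j,J)=(s,J)$. The lifted target set is $T_{\mathcal G}=\{(s,j,J) : s\in T,\ j\in J\subseteq I\}$, and the target observations are $T_Z=O(T_{\mathcal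 G})$. A policy on $\mathcal G_{\mathcal N}$ is observation-based if it takes the same value on any two paths with the same sequence of observations and actions; an observation-based policy is winning if under it, from the initial distribution $\iota'$, the run visits $O^{-1}(T_Z)$ with probability $1$. Then there exists a winning policy for $(\mathcal N,T)$ if and only if there exists a winning observation-based policy in $\mathcal G_{\mathcal N}$. -/

import Mathlib

open MeasureTheory ProbabilityTheory

/-- A Markov decision process with states `S` and actions `A` (both assumed finite wherever the
process is run); every action is enabled in every state. -/
structure MDP (S A : Type*) where
  /-- initial distribution -/
  init : PMF S
  /-- transition function -/
  p : S → A → PMF S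

/-- The finite sequence `s₀ a₀ s₁ a₁ … sₙ` of `n + 1` states and `n` actions. -/
@[ext]
structure History (S A : Type*) (n : ℕ) where
  state : Fin (n + 1) → S
  action : Fin n → A

/-- A finite sequence is a path of the MDP if it starts in the support of the initial distribution
and all its transitions have positive probability. -/
def MDP.IsPath {S A : Type*} (M : MDP S A) {n : ℕ} (π : History S A n) : Prop :=
  0 < M.init (π.state 0) ∧
    ∀ i : Fin n, 0 < M.p (π.state i.castSucc) (π.action i) (π.state i.succ)

/-- A (history-dependent, randomized) policy. It is a total function on finite sequences; its
values on sequences that are not paths have no influence on any probability below. -/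
abbrev Policy (S A : Type*) := (n : ℕ) → History S A n → PMF A

/-- One entry `(sₙ, aₙ)` of an infinite run `s₀ a₀ s₁ a₁ …`. -/
@[ext]
structure RunStep (S A : Type*) where
  state : S
  action : A

instance {S A : Type*} : MeasurableSpace (RunStep S A) := ⊤

instance {S A : Type*} : DiscreteMeasurableSpace (RunStep S A) := ⟨fun _ => trivial⟩

instance {S A : Type*} [Finite S] [Finite A] : Finite (RunStep S A) :=
  Finite.of_injective (fun x => (x.state, x.action)) fun x y h => by
    cases x; cases y; simpa using h

/-- The path `s₀` of length zero. -/
def History.single {S : Type*} (A : Type*) (s : S) : History S A 0 where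
  state := fun _ => s
  action := Fin.elim0

/-- The finite sequence `s₀ a₀ … sₙ aₙ s'` from `(s₀, a₀), …, (sₙ, aₙ)` and `s'`. -/
def History.ofPrefix {S A : Type*} {n : ℕ} (x : Finset.Iic n → RunStep S A) (s' : S) :
    History S A (n + 1) where
  state := Fin.snoc (fun i : Fin (n + 1) =>
    (x ⟨i, Finset.mem_Iic.2 (Nat.lt_succ_iff.1 i.isLt)⟩).state) s'
  action := fun i => (x ⟨i, Finset.mem_Iic.2 (Nat.lt_succ_iff.1 i.isLt)⟩).action

namespace MDP

variable {S A : Type*}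

/-- The law of `(s₀, a₀)`: first `s₀` is drawn from the initial distribution, then `a₀` by the
policy. -/
noncomputable def initStep (M : MDP S A) (σ : Policy S A) : PMF (RunStep S A) :=
  M.init.bind fun s => (σ 0 (History.single A s)).map fun a => ⟨s, a⟩

/-- The law of `(sₙ₊₁, aₙ₊₁)` given `(s₀, a₀), …, (sₙ, aₙ)`: first `sₙ₊₁` is drawn by the transition
function, then `aₙ₊₁` by the policy. -/
noncomputable def nextStep (M : MDP S A) (σ : Policy S A) (n : ℕ)
    (x : Finset.Iic n → RunStep S A) : PMF (RunStep S A) :=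
  (M.p (x ⟨n, Finset.mem_Iic.2 le_rfl⟩).state (x ⟨n, Finset.mem_Iic.2 le_rfl⟩).action).bind
    fun s' => (σ (n + 1) (History.ofPrefix x s')).map fun a' => ⟨s', a'⟩

/-- `nextStep` as a probability kernel. -/
noncomputable def stepKernel [Finite S] [Finite A] (M : MDP S A) (σ : Policy S A) (n : ℕ) :
    Kernel (Finset.Iic n → RunStep S A) (RunStep S A) :=
  Kernel.ofFunOfCountable fun x => (M.nextStep σ n x).toMeasure

instance [Finite S] [Finite A] (M : MDP S A) (σ : Policy S A) (n : ℕ) :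
    IsMarkovKernel (M.stepKernel σ n) :=
  ⟨fun x => by
    change IsProbabilityMeasure (M.nextStep σ n x).toMeasure
    infer_instance⟩

/-- The probability measure that the policy induces on infinite runs (Ionescu-Tulcea). -/
noncomputable def runMeasure [Finite S] [Finite A] (M : MDP S A) (σ : Policy S A) :
    Measure (ℕ → RunStep S A) :=
  Kernel.trajMeasure (X := fun _ => RunStep S A) (M.initStep σ).toMeasure (M.stepKernel σ)

/-- The probability of reaching `T` under the policy, from the initial distribution. -/
noncomputable def reachProb [Finite S] [Finite A] (M : MDP S A) (σ : Policy S A) (T : Set S) :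
    ENNReal :=
  M.runMeasure σ {ω | ∃ n, (ω n).state ∈ T}

end MDP

/-- A partially observable MDP with observations `Z`. -/
structure POMDP (S A Z : Type*) extends MDP S A where
  /-- observation function -/
  obs : S → Z

/-- The observation sequence `O(s₀) a₀ O(s₁) … O(sₙ)` of a finite sequence. -/
def History.mapState {S A Z : Type*} (f : S → Z) {n : ℕ} (π : History S A n) : History Z A n where
  state := fun i => f (π.state i)
  action := π.action

/-- A policy is observation-based if it agrees on paths with equal observation sequences. -/
def POMDP.IsObservationBased {S A Z : Type*} (P : POMDP S A Z) (σ : Policy S A) : Prop :=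
  ∀ (n : ℕ) (π π' : History S A n), P.IsPath π → P.IsPath π' →
    π.mapState P.obs = π'.mapState P.obs → σ n π = σ n π'

/-- An observation-based policy is winning for the target observations `TZ` if it almost surely
reaches a state whose observation is in `TZ`. -/
def POMDP.IsWinning {S A Z : Type*} [Finite S] [Finite A] (P : POMDP S A Z) (TZ : Set Z)
    (σ : Policy S A) : Prop :=
  P.IsObservationBased σ ∧ P.reachProb σ (P.obs ⁻¹' TZ) = 1

/-- A multiple-environment MDP with environments `I`. -/
structure MEMDP (S A I : Type*) where
  /-- initial distribution -/
  init : PMF S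
  /-- transition function of each environment -/
  p : I → S → A → PMF S

namespace MEMDP

variable {S A I : Type*}

/-- The MDP of environment `i`. -/
def env (N : MEMDP S A I) (i : I) : MDP S A := ⟨N.init, N.p i⟩

/-- A policy is winning for `T` if it reaches `T` almost surely in every environment. -/
def IsWinning [Finite S] [Finite A] (N : MEMDP S A I) (T : Set S) (σ : Policy S A) : Prop :=
  ∀ i, (N.env i).reachProb σ T = 1

/-- The belief update: the environments in `J` in which the transition is possible. -/
def update (N : MEMDP S A I) (J : Set I) (s : S) (a : A) (s' : S) : Set I :=
  {i ∈ J | 0 < N.p i s a s'}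

/-- The belief-observation MDP: a state `(s, j, J)` holds the state `s`, the actual environment
`j` and the belief support `J`. The environment `j` is initially uniform, never changes and is not
observed. -/
noncomputable def bomdp [Fintype I] [Nonempty I] (N : MEMDP S A I) :
    POMDP (S × I × Set I) A (S × Set I) where
  init := N.init.bind fun s => (PMF.uniformOfFintype I).map fun j => (s, j, Set.univ)
  p := fun x a => (N.p x.2.1 x.1 a).map fun s' => (s', x.2.1, N.update x.2.2 x.1 a s')
  obs := fun x => (x.1, x.2.2)

/-- The lifted target states. -/
def liftTarget (_ : MEMDP S A I) (T : Set S) : Set (S × I × Set I) :=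
  {x | x.1 ∈ T ∧ x.2.1 ∈ x.2.2}

/-- The target observations: the observations of the lifted target states. -/
noncomputable def targetObs [Fintype I] [Nonempty I] (N : MEMDP S A I) (T : Set S) :
    Set (S × Set I) :=
  N.bomdp.obs '' N.liftTarget T

end MEMDP

/-! The belief is a deterministic function of the path so far, so a path in environment `j` lifts
uniquely to a path of the belief-observation MDP with hidden component `j`. If policies `σ` and `τ`
agree along this lifting (`Corresponds`), the law of the first steps under `τ` is the uniform
mixture over `j` of the lifted laws under `σ` (`prefixPMF_bomdp`). Hence the reachability
probability under `τ` is the average of those under `σ` (`reachProb_bomdp`), and a finite average of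
numbers at most 1 equals 1 iff each of them does.

It remains to produce corresponding policies. Given `σ`, let `τ` forget beliefs and environment.
Given an observation-based `τ`, evaluate it on a lift in any environment where the path is possible;
the choice is irrelevant because the environment is not observed. -/

/-- Extend a finite prefix of a run by one further step. -/
def appendStep {R : Type*} {n : ℕ} (x : Finset.Iic n → R) (r : R) : Finset.Iic (n + 1) → R :=
  fun k => if h : k.1 ≤ n then x ⟨k, Finset.mem_Iic.2 h⟩ else r

theorem appendStep_of_le {R : Type*} {n : ℕ} (x : Finset.Iic n → R) (r : R) {k : ℕ} (hk : k ≤ n)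
    (hk' : k ∈ Finset.Iic (n + 1)) : appendStep x r ⟨k, hk'⟩ = x ⟨k, Finset.mem_Iic.2 hk⟩ :=
  dif_pos hk

theorem appendStep_last {R : Type*} {n : ℕ} (x : Finset.Iic n → R) (r : R)
    (hk' : n + 1 ∈ Finset.Iic (n + 1)) : appendStep x r ⟨n + 1, hk'⟩ = r :=
  dif_neg (by simp)

/-- Allows policies to be compared on genuine paths only. -/
theorem PMF.bind_congr_support {α β : Type*} (p : PMF α) {f g : α → PMF β}
    (h : ∀ a ∈ p.support, f a = g a) : p.bind f = p.bind g := by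
  ext b
  simp only [PMF.bind_apply]
  refine tsum_congr fun a => ?_
  by_cases ha : p a = 0
  · simp [ha]
  · rw [h a ((PMF.mem_support_iff p a).2 ha)]

/-! ### Laws of finite prefixes and reachability -/

namespace MDP

variable {S A : Type*}

/-- The law of the first `n + 1` steps of a run. -/
noncomputable def prefixPMF (M : MDP S A) (σ : Policy S A) :
    (n : ℕ) → PMF (Finset.Iic n → RunStep S A)
  | 0 => (M.initStep σ).map fun r _ => r
  | n + 1 => (M.prefixPMF σ n).bind fun x => (M.nextStep σ n x).map (appendStep x)

/-- Reduces the infinite-run measure to discrete distributions defined by recursion. -/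
theorem map_frestrictLe_runMeasure [Finite S] [Finite A] (M : MDP S A) (σ : Policy S A) (n : ℕ) :
    (M.runMeasure σ).map (Preorder.frestrictLe n) = (M.prefixPMF σ n).toMeasure := by
  induction n with
  | zero =>
    rw [runMeasure, Kernel.trajMeasure, Measure.map_comp _ _ (by fun_prop),
      Kernel.traj_map_frestrictLe, Kernel.partialTraj_self, Measure.id_comp, prefixPMF,
      ← PMF.toMeasure_map _ _ (measurable_of_countable _)]
    rfl
  | succ n ih =>
    have hfun : (Preorder.frestrictLe (n + 1) : (ℕ → RunStep S A) → _) =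
        (fun y : (Finset.Iic n → RunStep S A) × RunStep S A => appendStep y.1 y.2) ∘
          fun ω => (Preorder.frestrictLe n ω, ω (n + 1)) := by
      funext ω ⟨k, hk⟩
      rcases (Finset.mem_Iic.1 hk).lt_or_eq with h | rfl
      · exact (appendStep_of_le (Preorder.frestrictLe n ω) _ (Nat.lt_succ_iff.1 h) hk).symm
      · exact (appendStep_last (Preorder.frestrictLe n ω) _ hk).symm
    have hm : Measurable fun y : (Finset.Iic n → RunStep S A) × RunStep S A =>
        appendStep y.1 y.2 := measurable_of_countable _
    rw [hfun, ← Measure.map_map hm (by fun_prop), runMeasure,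
      ← Kernel.map_frestrictLe_trajMeasure_compProd_eq_map_trajMeasure, ← runMeasure, ih]
    ext s hs
    rw [Measure.map_apply hm hs, Measure.compProd_apply (hm hs), lintegral_countable', prefixPMF,
      PMF.toMeasure_bind_apply _ _ _ hs]
    refine tsum_congr fun x => ?_
    rw [PMF.toMeasure_apply_singleton _ _ (measurableSet_singleton x),
      PMF.toMeasure_map_apply _ _ _ (measurable_of_countable _) hs, mul_comm]
    rfl

theorem reachProb_eq_iSup [Finite S] [Finite A] (M : MDP S A) (σ : Policy S A) (T : Set S) :
    M.reachProb σ T = ⨆ n, (M.prefixPMF σ n).toMeasure {x | ∃ k, (x k).state ∈ T} := by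
  have hset : {ω : ℕ → RunStep S A | ∃ n, (ω n).state ∈ T} =
      ⋃ n, Preorder.frestrictLe n ⁻¹'
        {x : Finset.Iic n → RunStep S A | ∃ k, (x k).state ∈ T} := by
    ext ω
    simp only [Set.mem_ofPred_eq, Set.mem_iUnion, Set.mem_preimage]
    constructor
    · rintro ⟨n, hn⟩
      exact ⟨n, ⟨n, Finset.mem_Iic.2 le_rfl⟩, hn⟩
    · rintro ⟨n, k, hk⟩
      exact ⟨k, hk⟩
  have hmono : Monotone fun n : ℕ => (Preorder.frestrictLe n ⁻¹'
      {x : Finset.Iic n → RunStep S A | ∃ k, (x k).state ∈ T} : Set (ℕ → RunStep S A)) := by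
    rintro m n hmn ω ⟨k, hk⟩
    exact ⟨⟨k, Finset.mem_Iic.2 ((Finset.mem_Iic.1 k.2).trans hmn)⟩, hk⟩
  rw [reachProb, hset, hmono.measure_iUnion]
  refine iSup_congr fun n => ?_
  rw [← map_frestrictLe_runMeasure, Measure.map_apply (by fun_prop) (Set.toFinite _).measurableSet]

theorem monotone_prefixPMF_reach [Finite S] [Finite A] (M : MDP S A) (σ : Policy S A)
    (T : Set S) :
    Monotone fun n => (M.prefixPMF σ n).toMeasure {x | ∃ k, (x k).state ∈ T} := by
  intro m n hmn
  simp only [← map_frestrictLe_runMeasure]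
  rw [Measure.map_apply (by fun_prop) (Set.toFinite _).measurableSet,
    Measure.map_apply (by fun_prop) (Set.toFinite _).measurableSet]
  refine measure_mono ?_
  rintro ω ⟨k, hk⟩
  exact ⟨⟨k, Finset.mem_Iic.2 ((Finset.mem_Iic.1 k.2).trans hmn)⟩, hk⟩

theorem reachProb_le_one [Finite S] [Finite A] (M : MDP S A) (σ : Policy S A) (T : Set S) :
    M.reachProb σ T ≤ 1 := by
  rw [reachProb_eq_iSup]
  exact iSup_le fun n => prob_le_one

/-- A finite prefix of a run that only uses transitions of positive probability. -/
def IsPrefixPath (M : MDP S A) {n : ℕ} (x : Finset.Iic n → RunStep S A) : Prop :=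
  0 < M.init (x ⟨0, Finset.mem_Iic.2 n.zero_le⟩).state ∧
    ∀ (m : ℕ) (h : m + 1 ≤ n), 0 < M.p (x ⟨m, Finset.mem_Iic.2 (Nat.le_of_succ_le h)⟩).state
      (x ⟨m, Finset.mem_Iic.2 (Nat.le_of_succ_le h)⟩).action (x ⟨m + 1, Finset.mem_Iic.2 h⟩).state

theorem isPrefixPath_of_mem_support (M : MDP S A) (σ : Policy S A) {n : ℕ}
    {x : Finset.Iic n → RunStep S A} (hx : x ∈ (M.prefixPMF σ n).support) : M.IsPrefixPath x := by
  induction n with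
  | zero =>
    simp only [prefixPMF, initStep, PMF.mem_support_map_iff, PMF.mem_support_bind_iff] at hx
    obtain ⟨r, ⟨s, hs, a, -, rfl⟩, rfl⟩ := hx
    exact ⟨pos_iff_ne_zero.2 hs, fun m h => absurd h (by simp)⟩
  | succ n ih =>
    simp only [prefixPMF, nextStep, PMF.mem_support_map_iff, PMF.mem_support_bind_iff] at hx
    obtain ⟨y, hy, r, ⟨s, hs, a, -, rfl⟩, rfl⟩ := hx
    obtain ⟨h0, hp⟩ := ih hy
    refine ⟨by rwa [appendStep_of_le _ _ n.zero_le], fun m h => ?_⟩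
    rw [appendStep_of_le _ _ (Nat.le_of_succ_le_succ h)]
    rcases (Nat.le_of_succ_le_succ h).lt_or_eq with h' | rfl
    · rw [appendStep_of_le _ _ h']
      exact hp m h'
    · rw [appendStep_last]
      exact pos_iff_ne_zero.2 hs

theorem IsPrefixPath.isPath_ofPrefix {M : MDP S A} {n : ℕ} {x : Finset.Iic n → RunStep S A}
    (hx : M.IsPrefixPath x) {s : S}
    (hs : 0 < M.p (x ⟨n, Finset.mem_Iic.2 le_rfl⟩).state (x ⟨n, Finset.mem_Iic.2 le_rfl⟩).action
      s) : M.IsPath (History.ofPrefix x s) := by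
  constructor
  · have h0 : (0 : Fin (n + 1 + 1)) = Fin.castSucc 0 := rfl
    simp only [History.ofPrefix]
    rw [h0, Fin.snoc_castSucc]
    exact hx.1
  · intro i
    simp only [History.ofPrefix, Fin.snoc_castSucc]
    induction i using Fin.lastCases with
    | last =>
      rw [Fin.succ_last, Fin.snoc_last]
      exact hs
    | cast i =>
      rw [Fin.succ_castSucc, Fin.snoc_castSucc]
      exact hx.2 i i.2

end MDP

/-! ### Lifting paths along the belief update -/

namespace MEMDP

variable {S A I : Type*}

/-- The environments in which all transitions of a finite prefix up to time `k` are possible. -/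
def belief (N : MEMDP S A I) {n : ℕ} (x : Finset.Iic n → RunStep S A) (k : Finset.Iic n) : Set I :=
  {i | ∀ (m : ℕ) (h : m + 1 ≤ k.1),
    0 < N.p i (x ⟨m, Finset.mem_Iic.2 ((Nat.le_of_succ_le h).trans (Finset.mem_Iic.1 k.2))⟩).state
      (x ⟨m, Finset.mem_Iic.2 ((Nat.le_of_succ_le h).trans (Finset.mem_Iic.1 k.2))⟩).action
      (x ⟨m + 1, Finset.mem_Iic.2 (h.trans (Finset.mem_Iic.1 k.2))⟩).state}

/-- The prefix of a run of the belief-observation MDP that corresponds to a prefix of a run in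
environment `j`. -/
def liftPrefix (N : MEMDP S A I) (j : I) {n : ℕ} (x : Finset.Iic n → RunStep S A) :
    Finset.Iic n → RunStep (S × I × Set I) A :=
  fun k => ⟨((x k).state, j, N.belief x k), (x k).action⟩

/-- The path of the belief-observation MDP that corresponds to a path in environment `j`. -/
def liftHistory (N : MEMDP S A I) (j : I) {n : ℕ} (π : History S A n) :
    History (S × I × Set I) A n where
  state := fun k => (π.state k, j, {i | ∀ m : Fin n, m.castSucc < k →
    0 < N.p i (π.state m.castSucc) (π.action m) (π.state m.succ)})
  action := π.action

theorem liftHistory_single (N : MEMDP S A I) (j : I) (s : S) :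
    N.liftHistory j (History.single A s) = History.single A (s, j, Set.univ) := by
  ext k
  · rfl
  · rfl
  · simp [liftHistory, History.single]
  · exact k.elim0

theorem belief_appendStep_last (N : MEMDP S A I) {n : ℕ} (x : Finset.Iic n → RunStep S A)
    (s : S) (a : A) (h : n + 1 ∈ Finset.Iic (n + 1)) :
    N.belief (appendStep x ⟨s, a⟩) ⟨n + 1, h⟩ =
      N.update (N.belief x ⟨n, Finset.mem_Iic.2 le_rfl⟩) (x ⟨n, Finset.mem_Iic.2 le_rfl⟩).state
        (x ⟨n, Finset.mem_Iic.2 le_rfl⟩).action s := by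
  ext i
  constructor
  · intro hi
    refine ⟨fun m hm => ?_, ?_⟩
    · have := hi m (Nat.le_succ_of_le hm)
      rwa [appendStep_of_le _ _ (Nat.le_of_succ_le hm), appendStep_of_le _ _ hm] at this
    · have := hi n le_rfl
      rwa [appendStep_of_le _ _ le_rfl, appendStep_last] at this
  · rintro ⟨h₁, h₂⟩ m hm
    rw [appendStep_of_le _ _ (Nat.le_of_succ_le_succ hm)]
    rcases (Nat.le_of_succ_le_succ hm).lt_or_eq with h' | rfl
    · rw [appendStep_of_le _ _ h']
      exact h₁ m h'
    · rw [appendStep_last]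
      exact h₂

theorem liftPrefix_appendStep (N : MEMDP S A I) (j : I) {n : ℕ} (x : Finset.Iic n → RunStep S A)
    (s : S) (a : A) :
    N.liftPrefix j (appendStep x ⟨s, a⟩) = appendStep (N.liftPrefix j x)
      ⟨(s, j, N.update (N.belief x ⟨n, Finset.mem_Iic.2 le_rfl⟩)
        (x ⟨n, Finset.mem_Iic.2 le_rfl⟩).state (x ⟨n, Finset.mem_Iic.2 le_rfl⟩).action s), a⟩ := by
  funext ⟨k, hk⟩
  rcases (Finset.mem_Iic.1 hk).lt_or_eq with h | rfl
  · have hkn : k ≤ n := Nat.lt_succ_iff.1 h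
    rw [appendStep_of_le _ _ hkn]
    simp only [liftPrefix, appendStep_of_le _ _ hkn]
    congr 3
    ext i
    refine forall₂_congr fun m hm => ?_
    rw [appendStep_of_le _ _ ((Nat.le_of_succ_le hm).trans hkn),
      appendStep_of_le _ _ (le_trans hm hkn)]
  · rw [appendStep_last]
    simp only [liftPrefix, appendStep_last, belief_appendStep_last]

/-- Policies read histories while the prefix laws live on sequences of steps; this matches the two
forms of lifting. -/
theorem liftHistory_ofPrefix (N : MEMDP S A I) (j : I) {n : ℕ} (x : Finset.Iic n → RunStep S A)
    (s : S) :
    N.liftHistory j (History.ofPrefix x s) = History.ofPrefix (N.liftPrefix j x)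
      (s, j, N.update (N.belief x ⟨n, Finset.mem_Iic.2 le_rfl⟩)
        (x ⟨n, Finset.mem_Iic.2 le_rfl⟩).state (x ⟨n, Finset.mem_Iic.2 le_rfl⟩).action s) := by
  refine History.ext (funext fun k => ?_) rfl
  induction k using Fin.lastCases with
  | last =>
    simp only [liftHistory, History.ofPrefix, Fin.snoc_last, Fin.snoc_castSucc]
    congr 2
    ext i
    constructor
    · intro hi
      refine ⟨fun m hm => ?_, ?_⟩
      · have := hi (Fin.castSucc ⟨m, hm⟩) (Fin.castSucc_lt_last _)
        rwa [Fin.succ_castSucc, Fin.snoc_castSucc] at this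
      · have := hi (Fin.last n) (Fin.castSucc_lt_last _)
        rwa [Fin.succ_last, Fin.snoc_last] at this
    · rintro ⟨h₁, h₂⟩ m -
      induction m using Fin.lastCases with
      | last =>
        rw [Fin.succ_last, Fin.snoc_last]
        exact h₂
      | cast m =>
        rw [Fin.succ_castSucc, Fin.snoc_castSucc]
        exact h₁ m m.2
  | cast k =>
    simp only [liftHistory, History.ofPrefix, Fin.snoc_castSucc]
    simp only [liftPrefix]
    congr 2
    ext i
    constructor
    · intro hi m hm
      have := hi (Fin.castSucc ⟨m, hm.trans (Nat.lt_succ_iff.1 k.2)⟩) (Fin.lt_def.2 hm)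
      rwa [Fin.succ_castSucc, Fin.snoc_castSucc] at this
    · intro hi m hm
      induction m using Fin.lastCases with
      | last => exact absurd (Fin.lt_def.1 hm) (by simpa using Nat.lt_succ_iff.1 k.2)
      | cast m =>
        rw [Fin.succ_castSucc, Fin.snoc_castSucc]
        exact hi m (Fin.lt_def.1 hm)

theorem mem_belief_of_isPrefixPath (N : MEMDP S A I) {j : I} {n : ℕ}
    {x : Finset.Iic n → RunStep S A} (hx : (N.env j).IsPrefixPath x) (k : Finset.Iic n) :
    j ∈ N.belief x k :=
  fun m h => hx.2 m (h.trans (Finset.mem_Iic.1 k.2))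

/-! ### Comparison of the two models -/

section Bomdp

variable [Fintype I] [Nonempty I]

theorem mem_targetObs_iff (N : MEMDP S A I) (T : Set S) (s : S) (J : Set I) :
    (s, J) ∈ N.targetObs T ↔ s ∈ T ∧ J.Nonempty := by
  constructor
  · rintro ⟨⟨s', j, J'⟩, ⟨hs, hj⟩, h⟩
    obtain ⟨rfl, rfl⟩ := Prod.mk.inj h
    exact ⟨hs, j, hj⟩
  · rintro ⟨hs, j, hj⟩
    exact ⟨(s, j, J), ⟨hs, hj⟩, rfl⟩

theorem isPath_liftHistory (N : MEMDP S A I) {j : I} {n : ℕ} {π : History S A n}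
    (hπ : (N.env j).IsPath π) : N.bomdp.IsPath (N.liftHistory j π) := by
  constructor
  · refine pos_iff_ne_zero.2 ((PMF.mem_support_iff _ _).1 ?_)
    simp only [bomdp, PMF.mem_support_bind_iff, PMF.mem_support_map_iff]
    refine ⟨π.state 0, hπ.1.ne', j, by simp, ?_⟩
    simp [liftHistory]
  · intro i
    refine pos_iff_ne_zero.2 ((PMF.mem_support_iff _ _).1 ?_)
    simp only [bomdp, PMF.mem_support_map_iff]
    refine ⟨π.state i.succ, (hπ.2 i).ne', ?_⟩
    simp only [liftHistory]
    congr 2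
    ext e
    constructor
    · rintro ⟨h₁, h₂⟩ m hm
      rcases (Fin.castSucc_lt_succ_iff.1 hm).lt_or_eq with h | rfl
      · exact h₁ m (Fin.castSucc_lt_castSucc_iff.2 h)
      · exact h₂
    · exact fun h => ⟨fun m hm => h m (hm.trans i.castSucc_lt_succ), h i i.castSucc_lt_succ⟩

/-- A policy of the belief-observation MDP that makes the same choices as a policy of the MEMDP. -/
def Corresponds (N : MEMDP S A I) (σ : Policy S A) (τ : Policy (S × I × Set I) A) : Prop :=
  ∀ (j : I) (n : ℕ) (π : History S A n), (N.env j).IsPath π → τ n (N.liftHistory j π) = σ n π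

theorem prefixPMF_bomdp (N : MEMDP S A I) {σ : Policy S A} {τ : Policy (S × I × Set I) A}
    (h : N.Corresponds σ τ) (n : ℕ) :
    N.bomdp.prefixPMF τ n = (PMF.uniformOfFintype I).bind fun j =>
      ((N.env j).prefixPMF σ n).map (N.liftPrefix j) := by
  induction n with
  | zero =>
    simp only [MDP.prefixPMF, MDP.initStep, bomdp, env, PMF.map_bind, PMF.bind_bind, PMF.bind_map,
      PMF.map_comp]
    -- The initial law draws the state before the environment; the mixture draws the environment
    -- first.
    rw [PMF.bind_comm]
    refine PMF.bind_congr_support _ fun j _ => PMF.bind_congr_support _ fun s hs => ?_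
    have hp : (N.env j).IsPath (History.single A s) :=
      ⟨pos_iff_ne_zero.2 hs, fun i => i.elim0⟩
    simp only [Function.comp_apply]
    rw [← N.liftHistory_single, h j 0 _ hp, PMF.map_comp]
    congr 1
    funext a k
    obtain ⟨k, hk⟩ := k
    obtain rfl : k = 0 := Nat.le_zero.1 (Finset.mem_Iic.1 hk)
    simp [liftPrefix, belief]
  | succ n ih =>
    simp only [MDP.prefixPMF]
    rw [ih]
    simp only [PMF.bind_bind, PMF.bind_map, PMF.map_bind]
    refine PMF.bind_congr_support _ fun j _ => PMF.bind_congr_support _ fun x hx => ?_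
    have hx' := (N.env j).isPrefixPath_of_mem_support σ hx
    simp only [Function.comp_apply, MDP.nextStep, PMF.map_bind, PMF.map_comp]
    simp only [bomdp, env, PMF.bind_map]
    refine PMF.bind_congr_support _ fun s hs => ?_
    simp only [Function.comp_apply]
    have hp := hx'.isPath_ofPrefix (pos_iff_ne_zero.2 hs)
    have hτ := h j (n + 1) _ hp
    rw [liftHistory_ofPrefix] at hτ
    simp only [liftPrefix] at hτ ⊢
    rw [hτ]
    congr 1
    funext a
    simp only [Function.comp_apply]
    exact (N.liftPrefix_appendStep j x s a).symm

theorem reachProb_bomdp [Finite S] [Finite A] (N : MEMDP S A I) (T : Set S) {σ : Policy S A}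
    {τ : Policy (S × I × Set I) A} (h : N.Corresponds σ τ) :
    N.bomdp.reachProb τ (N.bomdp.obs ⁻¹' N.targetObs T) =
      ∑ j, (Fintype.card I : ENNReal)⁻¹ * (N.env j).reachProb σ T := by
  simp only [MDP.reachProb_eq_iSup, ENNReal.mul_iSup]
  -- Monotonicity in the horizon lets the finite sum and the supremum commute.
  rw [ENNReal.finsetSum_iSup_of_monotone fun j m n hmn =>
    mul_le_mul_right ((N.env j).monotone_prefixPMF_reach σ T hmn) _]
  refine iSup_congr fun n => ?_
  rw [prefixPMF_bomdp N h, PMF.toMeasure_bind_apply _ _ _ (Set.toFinite _).measurableSet,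
    tsum_fintype]
  refine Finset.sum_congr rfl fun j _ => ?_
  rw [PMF.uniformOfFintype_apply, PMF.toMeasure_map_apply _ _ _ (measurable_of_countable _)
    (Set.toFinite _).measurableSet]
  congr 1
  -- The two events need only agree on the support: there the true environment `j` lies in every
  -- belief, so the nonemptiness condition in `mem_targetObs_iff` is automatic.
  refine PMF.toMeasure_apply_eq_of_inter_support_eq _ (Set.toFinite _).measurableSet
    (Set.toFinite _).measurableSet ?_
  ext x
  simp only [Set.mem_inter_iff, and_congr_left_iff, Set.mem_preimage, Set.mem_ofPred_eq]
  intro hx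
  refine exists_congr fun k => ?_
  exact (N.mem_targetObs_iff T _ _).trans (and_iff_left
    ⟨j, N.mem_belief_of_isPrefixPath ((N.env j).isPrefixPath_of_mem_support σ hx) k⟩)

end Bomdp

end MEMDP

/-! ### Averages and the equivalence -/

theorem ENNReal.sum_inv_card_mul_eq_one_iff {I : Type*} [Fintype I] [Nonempty I]
    {r : I → ENNReal} (hr : ∀ i, r i ≤ 1) :
    ∑ i, (Fintype.card I : ENNReal)⁻¹ * r i = 1 ↔ ∀ i, r i = 1 := by
  have hc : (Fintype.card I : ENNReal) ≠ 0 := by simp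
  have hc' : (Fintype.card I : ENNReal) ≠ ⊤ := by simp
  constructor
  · intro h
    -- Termwise equality from equal sums needs cancellation, which fails at `⊤`.
    lift r to I → NNReal using fun i => ne_top_of_le_ne_top one_ne_top (hr i)
    have hsum : ∑ i, r i = ∑ _i : I, (1 : NNReal) := by
      rw [← Finset.mul_sum, mul_comm, ← div_eq_mul_inv, ENNReal.div_eq_one_iff hc hc'] at h
      simp only [Finset.sum_const, Finset.card_univ, nsmul_eq_mul, mul_one]
      exact_mod_cast h
    have := (Finset.sum_eq_sum_iff_of_le fun i _ => ENNReal.coe_le_one_iff.1 (hr i)).1 hsum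
    intro i
    exact ENNReal.coe_eq_one.2 (this i (Finset.mem_univ i))
  · intro h
    simp [h, ENNReal.mul_inv_cancel hc hc']

theorem MEMDP.Corresponds.isWinning_iff {S A I : Type*} [Finite S] [Finite A] [Fintype I]
    [Nonempty I] {N : MEMDP S A I} {σ : Policy S A} {τ : Policy (S × I × Set I) A}
    (h : N.Corresponds σ τ) (T : Set S) :
    N.IsWinning T σ ↔ N.bomdp.reachProb τ (N.bomdp.obs ⁻¹' N.targetObs T) = 1 := by
  rw [N.reachProb_bomdp T h,
    ENNReal.sum_inv_card_mul_eq_one_iff fun j => (N.env j).reachProb_le_one σ T]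
  rfl

theorem mainTheorem6 {S A I : Type*} [Finite S] [Finite A] [Fintype I] [Nonempty I]
    (N : MEMDP S A I) (T : Set S) :
    (∃ σ : Policy S A, N.IsWinning T σ) ↔
      ∃ σ : Policy (S × I × Set I) A, N.bomdp.IsWinning (N.targetObs T) σ := by
  constructor
  · rintro ⟨σ, hσ⟩
    have h : N.Corresponds σ fun n π => σ n (π.mapState Prod.fst) := fun j n π _ => rfl
    refine ⟨fun n π => σ n (π.mapState Prod.fst), fun n π π' _ _ hobs => ?_,
      (h.isWinning_iff T).1 hσ⟩
    exact congrArg (fun ρ : History (S × Set I) A n => σ n (ρ.mapState Prod.fst)) hobs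
  · rintro ⟨τ, hobs, hτ⟩
    classical
    -- The second branch is a junk value, on sequences that are paths in no environment.
    let σ : Policy S A := fun n π =>
      if hπ : ∃ j, (N.env j).IsPath π then τ n (N.liftHistory hπ.choose π)
      else τ n (N.liftHistory (Classical.arbitrary I) π)
    have h : N.Corresponds σ τ := by
      intro j n π hj
      have hπ : ∃ j, (N.env j).IsPath π := ⟨j, hj⟩
      simp only [σ, dif_pos hπ]
      -- The two lifts differ only in the hidden environment, so their observation sequences
      -- coincide definitionally.
      exact hobs n _ _ (N.isPath_liftHistory hj) (N.isPath_liftHistory hπ.choose_spec) rfl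
    exact ⟨σ, (h.isWinning_iff T).2 hτ⟩
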